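/- Let $\ell\ge 3$ be an integer and $\mathbb{Z}/\ell\mathbb{Z}$ the set of residues. Write $(a,b)$ for the position in row $a$ and column $b$ of a Young diagram in English notation, and give it the residue $b-a \bmod \ell$. The hook length $h^\lambda_{(a,b)}$ of a box $(a,b)$ of a partition $\lambda$ is the number of boxes of $\lambda$ that lie to the right of $(a,b)$ in row $a$ or below $(a,b)$ in column $b$, including $(a,b)$ itself. A partition $\lambda$ is an $(\ell,0)$-JM partition if there are no boxes $(a,b),(a,y),(x,b)$ of $\lambda$ such that $\ell\mid h^\lambda_{(a,b)}$, $\ell\nmid h^\lambda_{(a,y)}$ and $\ell\nmid h^\lambda_{(x,b)}$. Fix a residue $i$. An addable (removable) $i$-box of $\lambda$ is a position of residue $i$ outside $\lambda$ (a box of residue $i$ of $\lambda$) whose addition to (removal from) $\lambda$ gives a partition. Two positions $(a,b)$ and $(c,d)$ are on the same ladder if $c-a=(\ell-1)(b-d)$; ladders are ordered from left to right, that is, by increasing $a+(\ell-1)b$. Mark each addable $i$-box of $\lambda$ with $+$ and each removable $i$-box with $-$, and read these signs ladder by ladder from left to right, and from top to bottom on each ladder. Cancel adjacent pairs $-+$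 in this word repeatedly until a word of the form $+\cdots+-\cdots-$ remains. The number of its signs $+$ is $\widehat\varphi=\widehat\varphi_i(\lambda)$, and the number of its signs $-$ is $\widehat\varepsilon=\widehat\varepsilon_i(\lambda)$. The partition $\widehat f_i\lambda$ is obtained from $\lambda$ by adding the box of the rightmost remaining $+$, and $\widehat f_i\lambda=0$ if there is no $+$; the partition $\widehat e_i\lambda$ is obtained by removing the box of the leftmost remaining $-$, and $\widehat e_i\lambda=0$ if there is no $-$. Moreover $\widehat f_i0=\widehat e_i0=0$. Theorem. Suppose that $\lambda$ is an $(\ell,0)$-JM partition and $i\in\mathbb{Z}/\ell\mathbb{Z}$. Then 1. $\widehat f_i^{\,\widehat\varphi}\lambda$ is an $(\ell,0)$-JM partition (in particular it is not $0$), and 2. $\widehat e_i^{\,\widehat\varepsilon}\lambda$ is an $(\ell,0)$-JM partition (in particular it is not $0$), where $\widehat\varphi=\widehat\varphi_i(\lambda)$ and $\widehat\varepsilon=\widehat\varepsilon_i(\lambda)$. -/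

import Mathlib

/-!
Partitions are Young diagrams in English notation: the box `(a, b)` lies in row `a` and column `b`.
Rows and columns are counted from `0` (residues, hook lengths and the order of the ladders do not
change if they are counted from `1`).
-/

namespace LadderCrystal

/-- The hook length of the box `(a, b)` of `μ`: the number of boxes of `μ` weakly to the right in
row `a` or strictly below in column `b`. It is only used for boxes of `μ`. -/
def hookLength (μ : YoungDiagram) (a b : ℕ) : ℕ :=
  (μ.cells.filter fun c => (c.1 = a ∧ b ≤ c.2) ∨ (c.2 = b ∧ a < c.1)).card

/-- `μ` is an `(ℓ, 0)`-JM partition: there are no boxes `(a, b)`, `(a, y)`, `(x, b)` of `μ` such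
that `ℓ` divides the hook length of `(a, b)` but neither of the hook lengths of `(a, y)` and
`(x, b)`. -/
def IsJM (ℓ : ℕ) (μ : YoungDiagram) : Prop :=
  ¬ ∃ a b x y : ℕ, (a, b) ∈ μ ∧ (a, y) ∈ μ ∧ (x, b) ∈ μ ∧
    ℓ ∣ hookLength μ a b ∧ ¬ ℓ ∣ hookLength μ a y ∧ ¬ ℓ ∣ hookLength μ x b

/-- The residue of the box in row `a`, column `b` is `b - a` modulo `ℓ`. -/
def residue (ℓ : ℕ) (c : ℕ × ℕ) : ZMod ℓ := (c.2 : ZMod ℓ) - (c.1 : ZMod ℓ)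

/-- A position outside `μ` that can be added to give a Young diagram. -/
def IsAddable (μ : YoungDiagram) (c : ℕ × ℕ) : Prop :=
  c ∉ μ ∧ IsLowerSet ((insert c μ.cells : Finset (ℕ × ℕ)) : Set (ℕ × ℕ))

/-- A box of `μ` that can be removed to give a Young diagram. -/
def IsRemovable (μ : YoungDiagram) (c : ℕ × ℕ) : Prop :=
  c ∈ μ ∧ IsLowerSet ((μ.cells.erase c : Finset (ℕ × ℕ)) : Set (ℕ × ℕ))

theorem isAddable_iff (μ : YoungDiagram) (c : ℕ × ℕ) :
    IsAddable μ c ↔ c ∉ μ ∧ ∀ d ∈ Finset.Iic c, d ≠ c → d ∈ μ := by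
  refine and_congr_right fun hc => ⟨fun h d hd hne => ?_, fun h x y hyx hx => ?_⟩
  · have := h (Finset.mem_Iic.1 hd) (by simp : c ∈ _)
    simpa [hne] using this
  · simp only [Finset.coe_insert, Set.mem_insert_iff, Finset.mem_coe, YoungDiagram.mem_cells]
      at hx ⊢
    by_cases hy : y = c
    · exact Or.inl hy
    · right
      rcases hx with rfl | hx
      · exact h y (Finset.mem_Iic.2 hyx) hy
      · exact μ.isLowerSet hyx hx

theorem isRemovable_iff (μ : YoungDiagram) (c : ℕ × ℕ) :
    IsRemovable μ c ↔ c ∈ μ ∧ ∀ d ∈ μ.cells, c ≤ d → d = c := by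
  refine and_congr_right fun hc => ⟨fun h d hd hcd => ?_, fun h x y hyx hx => ?_⟩
  · by_contra hne
    have := h hcd (by simp [hne, (YoungDiagram.mem_cells d).1 hd] : d ∈ _)
    simp at this
  · simp only [Finset.coe_erase, Set.mem_sdiff, Set.mem_singleton_iff, Finset.mem_coe,
      YoungDiagram.mem_cells] at hx ⊢
    refine ⟨μ.isLowerSet hyx hx.1, ?_⟩
    rintro rfl
    exact hx.2 (h x hx.1 hyx)

instance (μ : YoungDiagram) (c : ℕ × ℕ) : Decidable (IsAddable μ c) :=
  decidable_of_iff' _ (isAddable_iff μ c)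

instance (μ : YoungDiagram) (c : ℕ × ℕ) : Decidable (IsRemovable μ c) :=
  decidable_of_iff' _ (isRemovable_iff μ c)

/-- The finite set of all addable and all removable `i`-boxes of `μ` (the range is large enough,
see `mem_markedBoxes`). -/
def markedBoxes (ℓ : ℕ) (i : ZMod ℓ) (μ : YoungDiagram) : Finset (ℕ × ℕ) :=
  (Finset.range (μ.colLen 0 + 1) ×ˢ Finset.range (μ.rowLen 0 + 1)).filter fun c =>
    residue ℓ c = i ∧ (IsAddable μ c ∨ IsRemovable μ c)

theorem mem_markedBoxes {ℓ : ℕ} {i : ZMod ℓ} {μ : YoungDiagram} {c : ℕ × ℕ} :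
    c ∈ markedBoxes ℓ i μ ↔ residue ℓ c = i ∧ (IsAddable μ c ∨ IsRemovable μ c) := by
  obtain ⟨a, b⟩ := c
  simp only [markedBoxes, Finset.mem_filter, Finset.mem_product, Finset.mem_range,
    and_iff_right_iff_imp]
  rintro ⟨-, h | h⟩
  · rw [isAddable_iff] at h
    constructor
    · by_contra! hlt
      have := h.2 (μ.colLen 0, 0) (by simp only [Finset.mem_Iic, Prod.mk_le_mk]; omega)
        (by simp only [ne_eq, Prod.mk.injEq]; omega)
      rw [YoungDiagram.mem_iff_lt_colLen] at this
      omega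
    · by_contra! hlt
      have := h.2 (0, μ.rowLen 0) (by simp only [Finset.mem_Iic, Prod.mk_le_mk]; omega)
        (by simp only [ne_eq, Prod.mk.injEq]; omega)
      rw [YoungDiagram.mem_iff_lt_rowLen] at this
      omega
  · have h1 := YoungDiagram.mem_iff_lt_colLen.1 (μ.up_left_mem le_rfl (Nat.zero_le b) h.1)
    have h2 := YoungDiagram.mem_iff_lt_rowLen.1 (μ.up_left_mem (Nat.zero_le a) le_rfl h.1)
    omega

/-- The number of the ladder through a position. Two positions `(a, b)`, `(c, d)` are on the same
ladder iff `c - a = (ℓ - 1) * (b - d)`, that is, iff these numbers agree; ladders further to the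
left have smaller numbers. -/
def ladder (ℓ : ℕ) (c : ℕ × ℕ) : ℕ := c.1 + (ℓ - 1) * c.2

/-- The ladder `i`-signature of `μ`: the addable and removable `i`-boxes of `μ`, read from the
leftmost ladder to the rightmost one, and from top to bottom on each ladder (they are sorted by
ladder, then by row). A box in the list carries the sign `-` if it belongs to `μ` (so that it is
removable) and the sign `+` if it does not (so that it is addable). -/
def signature (ℓ : ℕ) (i : ZMod ℓ) (μ : YoungDiagram) : List (ℕ × ℕ) :=
  (((markedBoxes ℓ i μ).image fun c => toLex (ladder ℓ c, toLex c)).sort).map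
    fun k => ofLex (ofLex k).2

/-- Put one more box in front of a reduced word and cancel the pair `- +` that may arise. -/
def consCancel (μ : YoungDiagram) (c : ℕ × ℕ) : List (ℕ × ℕ) → List (ℕ × ℕ)
  | [] => [c]
  | d :: w => if c ∈ μ ∧ d ∉ μ then w else c :: d :: w

/-- The result of cancelling adjacent pairs `- +` in a word as long as there are any (see
`cancel_spec`). -/
def cancel (μ : YoungDiagram) (w : List (ℕ × ℕ)) : List (ℕ × ℕ) :=
  w.foldr (consCancel μ) []

/-- One cancellation of an adjacent pair `- +`. -/
def CancelStep (μ : YoungDiagram) (w w' : List (ℕ × ℕ)) : Prop :=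
  ∃ u v c d, c ∈ μ ∧ d ∉ μ ∧ w = u ++ c :: d :: v ∧ w' = u ++ v

/-- `cancel` is obtained by cancelling adjacent pairs `- +`, and no such pair is left. -/
theorem cancel_spec (μ : YoungDiagram) (w : List (ℕ × ℕ)) :
    Relation.ReflTransGen (CancelStep μ) w (cancel μ w) ∧
      ∀ w', ¬ CancelStep μ (cancel μ w) w' := by
  induction w with
  | nil => exact ⟨.refl, by rintro _ ⟨u, v, c, d, -, -, h, -⟩; simp [cancel] at h⟩
  | cons c w ih =>
    obtain ⟨h1, h2⟩ := ih
    have h3 : Relation.ReflTransGen (CancelStep μ) (c :: w) (c :: cancel μ w) := by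
      refine h1.lift (c :: ·) ?_
      rintro _ _ ⟨u, v, d, e, hd, he, rfl, rfl⟩
      exact ⟨c :: u, v, d, e, hd, he, rfl, rfl⟩
    have h4 : cancel μ (c :: w) = consCancel μ c (cancel μ w) := rfl
    rw [h4]
    revert h2 h3
    cases cancel μ w with
    | nil =>
      intro h2 h3
      refine ⟨h3, ?_⟩
      rintro _ ⟨u, v, d, e, -, -, h, -⟩
      have := congrArg List.length h
      simp [consCancel] at this
      omega
    | cons d r =>
      intro h2 h3
      by_cases hcd : c ∈ μ ∧ d ∉ μ
      · simp only [consCancel, if_pos hcd]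
        refine ⟨h3.tail ⟨[], r, c, d, hcd.1, hcd.2, rfl, rfl⟩, ?_⟩
        rintro _ ⟨u, v, e, f, he, hf, rfl, rfl⟩
        exact h2 _ ⟨d :: u, v, e, f, he, hf, rfl, rfl⟩
      · simp only [consCancel, if_neg hcd]
        refine ⟨h3, ?_⟩
        rintro _ ⟨u, v, e, f, he, hf, h, rfl⟩
        cases u with
        | nil =>
          simp only [List.nil_append, List.cons.injEq] at h
          obtain ⟨rfl, rfl, rfl⟩ := h
          exact hcd ⟨he, hf⟩
        | cons g u =>
          simp only [List.cons_append, List.cons.injEq] at h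
          exact h2 _ ⟨u, v, e, f, he, hf, h.2, rfl⟩

/-- The reduced ladder `i`-signature of `μ`. -/
def reducedSignature (ℓ : ℕ) (i : ZMod ℓ) (μ : YoungDiagram) : List (ℕ × ℕ) :=
  cancel μ (signature ℓ i μ)

/-- The ladder normal `i`-boxes of `μ`, from left to right in the reduced signature. -/
def normalBoxes (ℓ : ℕ) (i : ZMod ℓ) (μ : YoungDiagram) : List (ℕ × ℕ) :=
  (reducedSignature ℓ i μ).filter fun c => c ∈ μ

/-- The ladder conormal `i`-boxes of `μ`, from left to right in the reduced signature. -/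
def conormalBoxes (ℓ : ℕ) (i : ZMod ℓ) (μ : YoungDiagram) : List (ℕ × ℕ) :=
  (reducedSignature ℓ i μ).filter fun c => c ∉ μ

/-- The number of ladder normal `i`-boxes. -/
def epsilonHat (ℓ : ℕ) (i : ZMod ℓ) (μ : YoungDiagram) : ℕ := (normalBoxes ℓ i μ).length

/-- The number of ladder conormal `i`-boxes. -/
def phiHat (ℓ : ℕ) (i : ZMod ℓ) (μ : YoungDiagram) : ℕ := (conormalBoxes ℓ i μ).length

/-- `μ` with an addable box added (`none` if the box is not addable). -/
def addBox (μ : YoungDiagram) (c : ℕ × ℕ) : Option YoungDiagram :=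
  if h : IsAddable μ c then some ⟨insert c μ.cells, h.2⟩ else none

/-- `μ` with a removable box removed (`none` if the box is not removable). -/
def removeBox (μ : YoungDiagram) (c : ℕ × ℕ) : Option YoungDiagram :=
  if h : IsRemovable μ c then some ⟨μ.cells.erase c, h.2⟩ else none

/-- The operator `f̂_i`: add the ladder cogood `i`-box, the rightmost `+` of the reduced ladder
signature; the value is `none` (the `0` of the crystal) if there is none. -/
def fHat (ℓ : ℕ) (i : ZMod ℓ) (μ : YoungDiagram) : Option YoungDiagram :=
  (conormalBoxes ℓ i μ).getLast?.bind (addBox μ)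

/-- The operator `ê_i`: remove the ladder good `i`-box, the leftmost `-` of the reduced ladder
signature; the value is `none` (the `0` of the crystal) if there is none. -/
def eHat (ℓ : ℕ) (i : ZMod ℓ) (μ : YoungDiagram) : Option YoungDiagram :=
  (normalBoxes ℓ i μ).head?.bind (removeBox μ)

/-- The `k`-th power of a crystal operator, where `0` is sent to `0`. -/
def iterate (g : YoungDiagram → Option YoungDiagram) (k : ℕ) (μ : YoungDiagram) :
    Option YoungDiagram :=
  (fun o => o.bind g)^[k] (some μ)

end LadderCrystal

namespace LadderCrystal

/-! Row `a` gives the bead `rowLen a - a` on the integer line and column `b` the gap `b - colLen b +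
1`; beads and gaps together partition the integers. A box is a gap to the left of a bead, and its
hook length is their difference, so the JM condition concerns the runners (classes mod `ℓ`) of beads
and gaps (`isJM_iff`).

Two facts carry the proof. In a JM partition all addable `i`-boxes precede all removable ones in the
ladder order (`IsJM.addableFirst`): otherwise-free beads or gaps between two such boxes are forced
onto one runner, hence lie at least `ℓ` apart, which makes the partition steep or flat enough to
order the ladders. So nothing cancels in the signature, and the maximal powers of the operators add
all addable, or remove all removable, `i`-boxes (`iterate_fHat`, `iterate_eHat`).

On beads this pushes every bead of runner `i` one step right where that place is free, or every bead
of runner `i + 1` one step left. A forbidden configuration after the move can be traced back to one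
before it (`BeadJM.add`, `BeadJM.remove`). -/

/-! ### Beads, gaps and hook lengths. -/

/-- The set of beads of `μ`: one for each row. -/
def beads (μ : YoungDiagram) : Set ℤ := {x | ∃ a : ℕ, x = (μ.rowLen a : ℤ) - a}

theorem not_mem_beads_iff (μ : YoungDiagram) (x : ℤ) :
    x ∉ beads μ ↔ ∃ b : ℕ, x = (b : ℤ) - μ.colLen b + 1 := by
  constructor
  · intro hx
    have hex : ∃ a : ℕ, (μ.rowLen a : ℤ) - a ≤ x := by
      refine ⟨μ.rowLen 0 + x.natAbs, ?_⟩
      have := μ.rowLen_anti 0 (μ.rowLen 0 + x.natAbs) (Nat.zero_le _)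
      omega
    classical
    -- Row `a` is the first whose bead is not to the right of `x`. The column `b = x + a - 1` then
    -- ends just above row `a`, so its gap is `x`.
    obtain ⟨a, ha, hmin⟩ : ∃ a : ℕ, (μ.rowLen a : ℤ) - a ≤ x ∧
        ∀ m < a, ¬ (μ.rowLen m : ℤ) - m ≤ x :=
      ⟨Nat.find hex, Nat.find_spec hex, fun m hm => Nat.find_min hex hm⟩
    have hne : x ≠ (μ.rowLen a : ℤ) - a := fun h => hx ⟨a, h⟩
    obtain ⟨b, hb⟩ : ∃ b : ℕ, (b : ℤ) = x + a - 1 := ⟨(x + a - 1).toNat, by omega⟩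
    have h1 : (a, b) ∉ μ := by rw [YoungDiagram.mem_iff_lt_rowLen]; omega
    have h2 : a = 0 ∨ (a - 1, b) ∈ μ := by
      rcases Nat.eq_zero_or_pos a with h0 | h0
      · exact Or.inl h0
      · right
        have := hmin (a - 1) (by omega)
        rw [YoungDiagram.mem_iff_lt_rowLen]
        omega
    rw [YoungDiagram.mem_iff_lt_colLen] at h1 h2
    exact ⟨b, by omega⟩
  · rintro ⟨b, hb⟩ ⟨a, ha⟩
    have h1 := YoungDiagram.mem_iff_lt_rowLen (μ := μ) (i := a) (j := b)
    have h2 := YoungDiagram.mem_iff_lt_colLen (μ := μ) (i := a) (j := b)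
    by_cases h : (a, b) ∈ μ
    · have := h1.1 h; have := h2.1 h; omega
    · have := mt h1.2 h; have := mt h2.2 h; omega

/-- Bead minus gap is `(rowLen a - b) + (colLen b - a) - 1`. Both brackets are positive for a box of
`μ` and both are at most zero otherwise. -/
theorem mem_iff_gap_lt_bead (μ : YoungDiagram) (a b : ℕ) :
    (a, b) ∈ μ ↔ (b : ℤ) - μ.colLen b + 1 < (μ.rowLen a : ℤ) - a := by
  have h1 := YoungDiagram.mem_iff_lt_rowLen (μ := μ) (i := a) (j := b)
  have h2 := YoungDiagram.mem_iff_lt_colLen (μ := μ) (i := a) (j := b)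
  by_cases h : (a, b) ∈ μ
  · have := h1.1 h; have := h2.1 h; simp only [h, true_iff]; omega
  · have := mt h1.2 h; have := mt h2.2 h; simp only [h, false_iff]; omega

theorem hookLength_eq {μ : YoungDiagram} {a b : ℕ} (h : (a, b) ∈ μ) :
    (hookLength μ a b : ℤ) = ((μ.rowLen a : ℤ) - a) - ((b : ℤ) - μ.colLen b + 1) := by
  have h1 := YoungDiagram.mem_iff_lt_rowLen.1 h
  have h2 := YoungDiagram.mem_iff_lt_colLen.1 h
  have key : (μ.cells.filter fun c => (c.1 = a ∧ b ≤ c.2) ∨ (c.2 = b ∧ a < c.1)) =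
      ({a} ×ˢ Finset.Ico b (μ.rowLen a)) ∪ (Finset.Ico (a + 1) (μ.colLen b) ×ˢ {b}) := by
    ext ⟨x, y⟩
    simp only [Finset.mem_filter, YoungDiagram.mem_cells, Finset.mem_union, Finset.mem_product,
      Finset.mem_singleton, Finset.mem_Ico]
    constructor
    · rintro ⟨hm, ⟨rfl, hy⟩ | ⟨rfl, hx⟩⟩
      · exact Or.inl ⟨rfl, hy, YoungDiagram.mem_iff_lt_rowLen.1 hm⟩
      · exact Or.inr ⟨⟨hx, YoungDiagram.mem_iff_lt_colLen.1 hm⟩, rfl⟩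
    · rintro (⟨rfl, hy, hm⟩ | ⟨⟨hx, hm⟩, rfl⟩)
      · exact ⟨YoungDiagram.mem_iff_lt_rowLen.2 hm, Or.inl ⟨rfl, hy⟩⟩
      · exact ⟨YoungDiagram.mem_iff_lt_colLen.2 hm, Or.inr ⟨rfl, hx⟩⟩
  rw [hookLength, key, Finset.card_union_of_disjoint]
  · simp only [Finset.card_product, Finset.card_singleton, Nat.card_Ico]
    omega
  · rw [Finset.disjoint_left]
    rintro ⟨x, y⟩ hx hy
    simp only [Finset.mem_product, Finset.mem_singleton, Finset.mem_Ico] at hx hy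
    omega

/-- The `(ℓ, 0)`-JM condition in terms of the set of beads. -/
def BeadJM (ℓ : ℕ) (B : Set ℤ) : Prop :=
  ∀ x ∈ B, ∀ x' ∈ B, ∀ y ∉ B, ∀ y' ∉ B, y < x → y' < x → y < x' →
    (y : ZMod ℓ) = x → (y' : ZMod ℓ) ≠ x → (y : ZMod ℓ) ≠ x' → False

theorem dvd_hookLength_iff (ℓ : ℕ) {μ : YoungDiagram} {a b : ℕ} (h : (a, b) ∈ μ) :
    ℓ ∣ hookLength μ a b ↔ (((b : ℤ) - μ.colLen b + 1 : ℤ) : ZMod ℓ) =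
      (((μ.rowLen a : ℤ) - a : ℤ) : ZMod ℓ) := by
  rw [← Int.natCast_dvd_natCast, hookLength_eq h, ZMod.intCast_eq_intCast_iff_dvd_sub]

theorem isJM_iff (ℓ : ℕ) (μ : YoungDiagram) : IsJM ℓ μ ↔ BeadJM ℓ (beads μ) := by
  constructor
  · rintro h _ ⟨a, rfl⟩ _ ⟨c, rfl⟩ y hy y' hy' h1 h2 h3 h4 h5 h6
    obtain ⟨b, rfl⟩ := (not_mem_beads_iff μ y).1 hy
    obtain ⟨d, rfl⟩ := (not_mem_beads_iff μ y').1 hy'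
    rw [← mem_iff_gap_lt_bead] at h1 h2 h3
    rw [← dvd_hookLength_iff _ h1] at h4
    rw [ne_eq, ← dvd_hookLength_iff _ h2] at h5
    rw [ne_eq, ← dvd_hookLength_iff _ h3] at h6
    exact h ⟨a, b, c, d, h1, h2, h3, h4, h5, h6⟩
  · rintro h ⟨a, b, c, d, h1, h2, h3, h4, h5, h6⟩
    rw [dvd_hookLength_iff _ h1] at h4
    rw [dvd_hookLength_iff _ h2] at h5
    rw [dvd_hookLength_iff _ h3] at h6
    rw [mem_iff_gap_lt_bead] at h1 h2 h3
    exact h _ ⟨a, rfl⟩ _ ⟨c, rfl⟩ _ ((not_mem_beads_iff _ _).2 ⟨b, rfl⟩) _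
      ((not_mem_beads_iff _ _).2 ⟨d, rfl⟩) h1 h2 h3 h4 h5 h6

/-! ### Addable and removable boxes as moves of beads. -/

theorem isAddable_iff_neighbours (μ : YoungDiagram) (a b : ℕ) : IsAddable μ (a, b) ↔
    (a, b) ∉ μ ∧ (∀ a', a = a' + 1 → (a', b) ∈ μ) ∧ ∀ b', b = b' + 1 → (a, b') ∈ μ := by
  rw [isAddable_iff]
  refine and_congr_right fun hc => ⟨fun h => ⟨?_, ?_⟩, ?_⟩
  · rintro a' rfl
    exact h _ (by simp) (by simp)
  · rintro b' rfl
    exact h _ (by simp) (by simp)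
  · rintro ⟨h1, h2⟩ ⟨x, y⟩ hd hne
    simp only [Finset.mem_Iic, Prod.mk_le_mk, ne_eq, Prod.mk.injEq] at hd hne
    by_cases hx : x = a
    · exact μ.up_left_mem (j2 := b - 1) (by omega) (by omega) (h2 (b - 1) (by omega))
    · exact μ.up_left_mem (i2 := a - 1) (by omega) (by omega) (h1 (a - 1) (by omega))

theorem isRemovable_iff_neighbours (μ : YoungDiagram) (a b : ℕ) : IsRemovable μ (a, b) ↔
    (a, b) ∈ μ ∧ (a + 1, b) ∉ μ ∧ (a, b + 1) ∉ μ := by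
  rw [isRemovable_iff]
  refine and_congr_right fun hc => ⟨fun h => ⟨fun h' => ?_, fun h' => ?_⟩, ?_⟩
  · have := h _ h' (by simp)
    simp at this
  · have := h _ h' (by simp)
    simp at this
  · rintro ⟨h1, h2⟩ ⟨x, y⟩ hd hle
    rw [YoungDiagram.mem_cells] at hd
    simp only [Prod.mk_le_mk, Prod.mk.injEq] at hle ⊢
    by_contra hne
    by_cases hx : x = a
    · exact h2 (μ.up_left_mem (by omega) (by omega) hd)
    · exact h1 (μ.up_left_mem (by omega) (by omega) hd)

theorem IsAddable.lens {μ : YoungDiagram} {a b : ℕ} (h : IsAddable μ (a, b)) :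
    μ.rowLen a = b ∧ μ.colLen b = a := by
  obtain ⟨h0, h1, h2⟩ := (isAddable_iff_neighbours μ a b).1 h
  have h3 := h0
  rw [YoungDiagram.mem_iff_lt_rowLen] at h0
  rw [YoungDiagram.mem_iff_lt_colLen] at h3
  have h1' : a = 0 ∨ a - 1 < μ.colLen b := by
    rcases Nat.eq_zero_or_pos a with h | h
    · exact Or.inl h
    · exact Or.inr (YoungDiagram.mem_iff_lt_colLen.1 (h1 (a - 1) (by omega)))
  have h2' : b = 0 ∨ b - 1 < μ.rowLen a := by
    rcases Nat.eq_zero_or_pos b with h | h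
    · exact Or.inl h
    · exact Or.inr (YoungDiagram.mem_iff_lt_rowLen.1 (h2 (b - 1) (by omega)))
  omega

theorem IsRemovable.lens {μ : YoungDiagram} {a b : ℕ} (h : IsRemovable μ (a, b)) :
    μ.rowLen a = b + 1 ∧ μ.colLen b = a + 1 := by
  obtain ⟨h0, h1, h2⟩ := (isRemovable_iff_neighbours μ a b).1 h
  have h3 := h0
  rw [YoungDiagram.mem_iff_lt_rowLen] at h0 h2
  rw [YoungDiagram.mem_iff_lt_colLen] at h1 h3
  omega

/-- The place to the right of the bead of row `a` can only be taken by row `a - 1`, namely when both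
rows have the same length. -/
theorem bead_succ_not_mem_iff (μ : YoungDiagram) (a : ℕ) :
    (μ.rowLen a : ℤ) - a + 1 ∉ beads μ ↔ IsAddable μ (a, μ.rowLen a) := by
  constructor
  · intro h
    rw [isAddable_iff_neighbours]
    refine ⟨by rw [YoungDiagram.mem_iff_lt_rowLen]; omega, ?_, ?_⟩
    · rintro a' rfl
      rw [YoungDiagram.mem_iff_lt_rowLen]
      have := μ.rowLen_anti a' (a' + 1) (by omega)
      by_contra hlt
      exact h ⟨a', by push_cast; omega⟩
    · rintro b' hb
      rw [YoungDiagram.mem_iff_lt_rowLen]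
      omega
  · intro h
    rw [not_mem_beads_iff]
    exact ⟨μ.rowLen a, by rw [h.lens.2]⟩

theorem bead_pred_not_mem_iff (μ : YoungDiagram) (a : ℕ) :
    (μ.rowLen a : ℤ) - a - 1 ∉ beads μ ↔
      0 < μ.rowLen a ∧ IsRemovable μ (a, μ.rowLen a - 1) := by
  constructor
  · intro h
    have h0 := μ.rowLen_anti a (a + 1) (by omega)
    have h1 : μ.rowLen (a + 1) < μ.rowLen a := by
      by_contra hlt
      exact h ⟨a + 1, by push_cast; omega⟩
    refine ⟨by omega, ?_⟩
    rw [isRemovable_iff_neighbours]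
    simp only [YoungDiagram.mem_iff_lt_rowLen]
    omega
  · rintro ⟨h0, h⟩
    rw [not_mem_beads_iff]
    exact ⟨μ.rowLen a - 1, by rw [h.lens.2]; push_cast; omega⟩

theorem rowLen_eq_of_forall {μ : YoungDiagram} {a n : ℕ} (h : ∀ b, (a, b) ∈ μ ↔ b < n) :
    μ.rowLen a = n := by
  have h1 := h n
  have h2 := h (μ.rowLen a)
  rw [YoungDiagram.mem_iff_lt_rowLen] at h1 h2
  omega

/-- All addable `i`-boxes are added at once, so `ν` is described by membership alone and each row is
treated separately: its bead moves right exactly when it is on runner `i` and the next place is a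
gap. -/
theorem mem_beads_of_add {ℓ : ℕ} {i : ZMod ℓ} {μ ν : YoungDiagram}
    (h : ∀ c, c ∈ ν ↔ c ∈ μ ∨ (residue ℓ c = i ∧ IsAddable μ c)) (x : ℤ) :
    x ∈ beads ν ↔ (x ∈ beads μ ∧ ¬ ((x : ZMod ℓ) = i ∧ x + 1 ∉ beads μ)) ∨
      (x ∉ beads μ ∧ x - 1 ∈ beads μ ∧ ((x - 1 : ℤ) : ZMod ℓ) = i) := by
  have hres : ∀ a, residue ℓ (a, μ.rowLen a) = (((μ.rowLen a : ℤ) - a : ℤ) : ZMod ℓ) := by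
    intro a; simp [residue]
  have h1 : ∀ a, ((((μ.rowLen a : ℤ) - a : ℤ) : ZMod ℓ) = i ∧
      (μ.rowLen a : ℤ) - a + 1 ∉ beads μ) → ν.rowLen a = μ.rowLen a + 1 := by
    rintro a ⟨h1, h2⟩
    apply rowLen_eq_of_forall
    intro b
    rw [h, YoungDiagram.mem_iff_lt_rowLen]
    constructor
    · rintro (h | ⟨-, h⟩)
      · omega
      · have := h.lens.1; omega
    · intro hb
      rcases Nat.lt_succ_iff_lt_or_eq.1 hb with hb | rfl
      · exact Or.inl hb
      · exact Or.inr ⟨(hres a).trans h1, (bead_succ_not_mem_iff μ a).1 h2⟩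
  have h2 : ∀ a, ¬ ((((μ.rowLen a : ℤ) - a : ℤ) : ZMod ℓ) = i ∧
      (μ.rowLen a : ℤ) - a + 1 ∉ beads μ) → ν.rowLen a = μ.rowLen a := by
    rintro a h1
    apply rowLen_eq_of_forall
    intro b
    rw [h, YoungDiagram.mem_iff_lt_rowLen]
    constructor
    · rintro (h | ⟨hr, h⟩)
      · exact h
      · obtain rfl := h.lens.1
        exact (h1 ⟨(hres a).symm.trans hr, (bead_succ_not_mem_iff μ a).2 h⟩).elim
    · exact Or.inl
  constructor
  · rintro ⟨a, rfl⟩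
    by_cases hc : (((μ.rowLen a : ℤ) - a : ℤ) : ZMod ℓ) = i ∧ (μ.rowLen a : ℤ) - a + 1 ∉ beads μ
    · have e : ((ν.rowLen a : ℕ) : ℤ) - a = (μ.rowLen a : ℤ) - a + 1 := by
        rw [h1 a hc]; push_cast; ring
      rw [e, add_sub_cancel_right]
      exact Or.inr ⟨hc.2, ⟨a, rfl⟩, hc.1⟩
    · rw [h2 a hc]
      exact Or.inl ⟨⟨a, rfl⟩, hc⟩
  · rintro (⟨⟨a, rfl⟩, hc⟩ | ⟨hx, ⟨a, ha⟩, hi⟩)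
    · exact ⟨a, by rw [h2 a hc]⟩
    · refine ⟨a, ?_⟩
      obtain rfl : x = (μ.rowLen a : ℤ) - a + 1 := by omega
      rw [h1 a ⟨by rwa [add_sub_cancel_right] at hi, hx⟩]
      push_cast; ring

theorem mem_beads_of_remove {ℓ : ℕ} {i : ZMod ℓ} {μ ν : YoungDiagram}
    (h : ∀ c, c ∈ ν ↔ c ∈ μ ∧ ¬ (residue ℓ c = i ∧ IsRemovable μ c)) (x : ℤ) :
    x ∈ beads ν ↔ (x ∈ beads μ ∧ ¬ (((x - 1 : ℤ) : ZMod ℓ) = i ∧ x - 1 ∉ beads μ)) ∨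
      (x ∉ beads μ ∧ x + 1 ∈ beads μ ∧ (x : ZMod ℓ) = i) := by
  -- The residue of a removable box is the class of the place its bead moves to, not of the bead
  -- itself.
  have hres : ∀ a, 0 < μ.rowLen a → residue ℓ (a, μ.rowLen a - 1) =
      (((μ.rowLen a : ℤ) - a - 1 : ℤ) : ZMod ℓ) := by
    intro a ha
    simp [residue, Nat.cast_sub (Nat.succ_le_of_lt ha)]
    ring
  have h1 : ∀ a, ((((μ.rowLen a : ℤ) - a - 1 : ℤ) : ZMod ℓ) = i ∧
      (μ.rowLen a : ℤ) - a - 1 ∉ beads μ) → ν.rowLen a + 1 = μ.rowLen a := by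
    rintro a ⟨h1, h2⟩
    rw [bead_pred_not_mem_iff] at h2
    suffices ν.rowLen a = μ.rowLen a - 1 by omega
    apply rowLen_eq_of_forall
    intro b
    rw [h, YoungDiagram.mem_iff_lt_rowLen]
    constructor
    · rintro ⟨hb, hn⟩
      by_contra hlt
      obtain rfl : b = μ.rowLen a - 1 := by omega
      exact hn ⟨(hres a h2.1).trans h1, h2.2⟩
    · intro hb
      refine ⟨by omega, fun hn => ?_⟩
      have := hn.2.lens.1
      omega
  have h2 : ∀ a, ¬ ((((μ.rowLen a : ℤ) - a - 1 : ℤ) : ZMod ℓ) = i ∧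
      (μ.rowLen a : ℤ) - a - 1 ∉ beads μ) → ν.rowLen a = μ.rowLen a := by
    rintro a h1
    apply rowLen_eq_of_forall
    intro b
    rw [h, YoungDiagram.mem_iff_lt_rowLen]
    refine ⟨fun h => h.1, fun hb => ⟨hb, fun hn => h1 ?_⟩⟩
    have := hn.2.lens.1
    obtain rfl : b = μ.rowLen a - 1 := by omega
    exact ⟨(hres a (by omega)).symm.trans hn.1, (bead_pred_not_mem_iff μ a).2 ⟨by omega, hn.2⟩⟩
  constructor
  · rintro ⟨a, rfl⟩
    by_cases hc : (((μ.rowLen a : ℤ) - a - 1 : ℤ) : ZMod ℓ) = i ∧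
        (μ.rowLen a : ℤ) - a - 1 ∉ beads μ
    · have e : ((ν.rowLen a : ℕ) : ℤ) - a = (μ.rowLen a : ℤ) - a - 1 := by
        rw [← h1 a hc]; push_cast; ring
      rw [e, sub_add_cancel]
      exact Or.inr ⟨hc.2, ⟨a, rfl⟩, hc.1⟩
    · rw [h2 a hc]
      exact Or.inl ⟨⟨a, rfl⟩, hc⟩
  · rintro (⟨⟨a, rfl⟩, hc⟩ | ⟨hx, ⟨a, ha⟩, hi⟩)
    · exact ⟨a, by rw [h2 a hc]⟩
    · refine ⟨a, ?_⟩
      obtain rfl : x = (μ.rowLen a : ℤ) - a - 1 := by omega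
      have := h1 a ⟨hi, hx⟩
      omega

/-! ### Moving beads between adjacent runners. -/

theorem intCast_sub_one_ne {ℓ : ℕ} (hℓ : 1 < ℓ) (z : ℤ) : ((z - 1 : ℤ) : ZMod ℓ) ≠ z := by
  have : Fact (1 < ℓ) := ⟨hℓ⟩
  simp

theorem intCast_sub_one_eq_iff {ℓ : ℕ} (z y : ℤ) :
    ((z - 1 : ℤ) : ZMod ℓ) = ((y - 1 : ℤ) : ZMod ℓ) ↔ (z : ZMod ℓ) = y := by
  push_cast
  exact sub_left_inj

theorem lt_of_le_of_intCast_ne {ℓ : ℕ} {z y : ℤ} (h : z ≤ y) (hne : (z : ZMod ℓ) ≠ y) : z < y :=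
  lt_of_le_of_ne h fun e => hne (congrArg _ e)

/-- A bead and a gap to its left on the same runner, a further gap on another runner to the left
of the bead and a further bead on another runner to the right of the gap contradict the
`(ℓ, 0)`-JM condition. -/
theorem BeadJM.elim {ℓ : ℕ} {B : Set ℤ} (hB : BeadJM ℓ B) {x y : ℤ} (hx : x ∈ B) (hy : y ∉ B)
    (hlt : y < x) (hxy : (y : ZMod ℓ) = x)
    (hgap : ∃ y' ∉ B, y' ≤ x ∧ (y' : ZMod ℓ) ≠ x)
    (hbead : ∃ x' ∈ B, y ≤ x' ∧ (y : ZMod ℓ) ≠ x') : False := by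
  obtain ⟨y', h1, h2, h3⟩ := hgap
  obtain ⟨x', h4, h5, h6⟩ := hbead
  exact hB x hx x' h4 y hy y' h1 hlt (lt_of_le_of_intCast_ne h2 h3) (lt_of_le_of_intCast_ne h5 h6)
    hxy h3 h6

/-- Adding all addable boxes of a residue preserves the `(ℓ, 0)`-JM condition on beads. -/
theorem BeadJM.add {ℓ : ℕ} (hℓ : 1 < ℓ) {i : ZMod ℓ} {B B' : Set ℤ} (hB : BeadJM ℓ B)
    (hB' : ∀ x : ℤ, x ∈ B' ↔ (x ∈ B ∧ ¬ ((x : ZMod ℓ) = i ∧ x + 1 ∉ B)) ∨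
      (x ∉ B ∧ x - 1 ∈ B ∧ ((x - 1 : ℤ) : ZMod ℓ) = i)) : BeadJM ℓ B' := by
  have hne : ∀ z : ℤ, (z : ZMod ℓ) = i → ((z - 1 : ℤ) : ZMod ℓ) ≠ i :=
    fun z hz h => intCast_sub_one_ne hℓ z (h.trans hz.symm)
  have hS : ∀ z : ℤ, ((z + 1 - 1 : ℤ) : ZMod ℓ) = z := by intro z; rw [add_sub_cancel_right]
  have hI := intCast_sub_one_eq_iff (ℓ := ℓ)
  have hgap : ∀ z ∉ B', z ∉ B ∨ ((z : ZMod ℓ) = i ∧ z + 1 ∉ B) := by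
    intro z hz; rw [hB'] at hz; tauto
  have hbead : ∀ z ∈ B', z ∈ B ∨ (((z - 1 : ℤ) : ZMod ℓ) = i ∧ z - 1 ∈ B) := by
    intro z hz; rw [hB'] at hz; tauto
  -- After the move each pair of places on runners `i`, `i + 1` is right-justified: a gap on the
  -- right, or a bead on the left, determines the whole pair before the move.
  have hgap' : ∀ z ∉ B', ((z - 1 : ℤ) : ZMod ℓ) = i → z ∉ B ∧ z - 1 ∉ B := by
    intro z hz h; rw [hB'] at hz; have := fun h' => hne z h' h; tauto
  have hbead' : ∀ z ∈ B', (z : ZMod ℓ) = i → z ∈ B ∧ z + 1 ∈ B := by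
    intro z hz h; rw [hB'] at hz; have := hne z h; tauto
  intro x hx x' hx' y hy y' hy' h1 h2 h3 h4 h5 h6
  by_cases cx : (x : ZMod ℓ) = i
  · have cy := h4.trans cx
    obtain ⟨hx0, hx1⟩ := hbead' x hx cx
    -- If the bead at `y` has moved, the configuration is shifted to `x + 1`, `y + 1` on the next
    -- runner; otherwise `x`, `y` still serve.
    by_cases hyB : y ∈ B
    · have hy1 : y + 1 ∉ B := ((hgap y hy).resolve_left (not_not_intro hyB)).2
      have hy'B : y' ∉ B := (hgap y' hy').resolve_right fun h => h5 (h.1.trans cx.symm)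
      refine hB.elim hx1 hy1 (by omega) (by push_cast; rw [h4]) ?_
        ⟨x, hx0, by omega, fun h => hne _ (h.trans cx) ((hS y).trans cy)⟩
      by_cases k : ((y' - 1 : ℤ) : ZMod ℓ) = i
      · exact ⟨y' - 1, (hgap' y' hy' k).2, by omega,
          fun h => hne _ (h.symm.trans k) ((hS x).trans cx)⟩
      · exact ⟨y', hy'B, by omega, fun h => k (((hI y' (x + 1)).2 h).trans ((hS x).trans cx))⟩
    · exact hB.elim hx0 hyB h1 h4
        ⟨y', (hgap y' hy').resolve_right fun h => h5 (h.1.trans cx.symm), h2.le, h5⟩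
        ⟨x + 1, hx1, by omega, fun h => hne _ (h.symm.trans cy) ((hS x).trans cx)⟩
  · by_cases cx1 : ((x - 1 : ℤ) : ZMod ℓ) = i
    · have cy1 : ((y - 1 : ℤ) : ZMod ℓ) = i := ((hI y x).2 h4).trans cx1
      obtain ⟨hy0, hy1⟩ := hgap' y hy cy1
      have hx'B : x' ∈ B :=
        (hbead x' hx').resolve_right fun h => h6 ((hI y x').1 (cy1.trans h.1.symm))
      by_cases hxB : x ∈ B
      · exact hB.elim hxB hy0 h1 h4 ⟨y - 1, hy1, by omega, fun h => cx (h.symm.trans cy1)⟩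
          ⟨x', hx'B, h3.le, h6⟩
      · have hxB1 : x - 1 ∈ B := ((hbead x hx).resolve_left hxB).2
        refine hB.elim hxB1 hy1 (by omega) ((hI y x).2 h4)
          ⟨y, hy0, by omega, fun h => cx (h4.symm.trans (h.trans cx1))⟩ ?_
        by_cases k : (x' : ZMod ℓ) = i
        · exact ⟨x' + 1, (hbead' x' hx' k).2, by omega,
            fun h => hne _ (h.symm.trans cy1) ((hS x').trans k)⟩
        · exact ⟨x', hx'B, by omega, fun h => k (h.symm.trans cy1)⟩
    · have cy : (y : ZMod ℓ) ≠ i := fun h => cx (h4.symm.trans h)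
      refine hB.elim (x := x) (y := y) ((hbead x hx).resolve_right fun h => cx1 h.1)
        ((hgap y hy).resolve_right fun h => cy h.1) h1 h4 ?_ ?_
      · rcases hgap y' hy' with k | ⟨k, k'⟩
        · exact ⟨y', k, h2.le, h5⟩
        · exact ⟨y' + 1, k', by omega,
            fun h => cx1 (((hI (y' + 1) x).2 h).symm.trans ((hS y').trans k))⟩
      · rcases hbead x' hx' with k | ⟨k, k'⟩
        · exact ⟨x', k, h3.le, h6⟩
        · exact ⟨x' - 1, k', by omega, fun h => cy (h.trans k)⟩

/-- Removing all removable boxes of a residue preserves the `(ℓ, 0)`-JM condition on beads. -/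
theorem BeadJM.remove {ℓ : ℕ} (hℓ : 1 < ℓ) {i : ZMod ℓ} {B B' : Set ℤ} (hB : BeadJM ℓ B)
    (hB' : ∀ x : ℤ, x ∈ B' ↔ (x ∈ B ∧ ¬ (((x - 1 : ℤ) : ZMod ℓ) = i ∧ x - 1 ∉ B)) ∨
      (x ∉ B ∧ x + 1 ∈ B ∧ (x : ZMod ℓ) = i)) : BeadJM ℓ B' := by
  have hne : ∀ z : ℤ, (z : ZMod ℓ) = i → ((z - 1 : ℤ) : ZMod ℓ) ≠ i :=
    fun z hz h => intCast_sub_one_ne hℓ z (h.trans hz.symm)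
  have hS : ∀ z : ℤ, ((z + 1 - 1 : ℤ) : ZMod ℓ) = z := by intro z; rw [add_sub_cancel_right]
  have hI := intCast_sub_one_eq_iff (ℓ := ℓ)
  have hgap : ∀ z ∉ B', z ∉ B ∨ (((z - 1 : ℤ) : ZMod ℓ) = i ∧ z - 1 ∉ B) := by
    intro z hz; rw [hB'] at hz; tauto
  have hbead : ∀ z ∈ B', z ∈ B ∨ ((z : ZMod ℓ) = i ∧ z + 1 ∈ B) := by
    intro z hz; rw [hB'] at hz; tauto
  -- Now the pairs on runners `i`, `i + 1` are left-justified.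
  have hgap' : ∀ z ∉ B', (z : ZMod ℓ) = i → z ∉ B ∧ z + 1 ∉ B := by
    intro z hz h; rw [hB'] at hz; have := hne z h; tauto
  have hbead' : ∀ z ∈ B', ((z - 1 : ℤ) : ZMod ℓ) = i → z ∈ B ∧ z - 1 ∈ B := by
    intro z hz h; rw [hB'] at hz; have := fun h' => hne z h' h; tauto
  intro x hx x' hx' y hy y' hy' h1 h2 h3 h4 h5 h6
  by_cases cx : (x : ZMod ℓ) = i
  · have cy := h4.trans cx
    obtain ⟨hy0, hy1⟩ := hgap' y hy cy
    have hx'B : x' ∈ B := (hbead x' hx').resolve_right fun h => h6 (cy.trans h.1.symm)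
    by_cases hxB : x ∈ B
    · exact hB.elim hxB hy0 h1 h4
        ⟨y + 1, hy1, by omega, fun h => hne _ (h.trans cx) ((hS y).trans cy)⟩
        ⟨x', hx'B, h3.le, h6⟩
    · have hxB1 : x + 1 ∈ B := ((hbead x hx).resolve_left hxB).2
      refine hB.elim hxB1 hy1 (by omega) (by push_cast; rw [h4])
        ⟨y, hy0, by omega, fun h => hne _ (h.symm.trans cy) ((hS x).trans cx)⟩ ?_
      by_cases k : ((x' - 1 : ℤ) : ZMod ℓ) = i
      · have hx1 := (hbead' x' hx' k).2
        -- Needed for `y + 1 ≤ x' - 1`: from `y < x'` alone one unit would be missing.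
        have : x' - 1 ≠ y := fun h => hy0 (h ▸ hx1)
        exact ⟨x' - 1, hx1, by omega, fun h => hne _ (h.trans k) ((hS y).trans cy)⟩
      · exact ⟨x', hx'B, by omega, fun h => k (((hI (y + 1) x').2 h).symm.trans ((hS y).trans cy))⟩
  · by_cases cx1 : ((x - 1 : ℤ) : ZMod ℓ) = i
    · have cy1 : ((y - 1 : ℤ) : ZMod ℓ) = i := ((hI y x).2 h4).trans cx1
      obtain ⟨hx0, hx1⟩ := hbead' x hx cx1
      have hy'B : y' ∉ B :=
        (hgap y' hy').resolve_right fun h => h5 ((hI y' x).1 (h.1.trans cx1.symm))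
      by_cases hyB : y ∈ B
      · have hyB1 : y - 1 ∉ B := ((hgap y hy).resolve_left (not_not_intro hyB)).2
        refine hB.elim hx1 hyB1 (by omega) ((hI y x).2 h4) ?_
          ⟨x, hx0, by omega, fun h => cx (h.symm.trans cy1)⟩
        by_cases k : (y' : ZMod ℓ) = i
        · have : y' ≠ x - 1 := fun h => hy'B (h ▸ hx1)
          exact ⟨y' + 1, (hgap' y' hy' k).2, by omega,
            fun h => hne _ (h.trans cx1) ((hS y').trans k)⟩
        · exact ⟨y', hy'B, by omega, fun h => k (h.trans cx1)⟩
      · exact hB.elim hx0 hyB h1 h4 ⟨y', hy'B, h2.le, h5⟩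
          ⟨x - 1, hx1, by omega, fun h => cx (h4.symm.trans (h.trans cx1))⟩
    · have cy : (y : ZMod ℓ) ≠ i := fun h => cx (h4.symm.trans h)
      have cy1 : ((y - 1 : ℤ) : ZMod ℓ) ≠ i := fun h => cx1 (((hI y x).2 h4).symm.trans h)
      refine hB.elim (x := x) (y := y) ((hbead x hx).resolve_right fun h => cx h.1)
        ((hgap y hy).resolve_right fun h => cy1 h.1) h1 h4 ?_ ?_
      · rcases hgap y' hy' with k | ⟨k, k'⟩
        · exact ⟨y', k, h2.le, h5⟩
        · exact ⟨y' - 1, k', by omega, fun h => cx (h.symm.trans k)⟩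
      · rcases hbead x' hx' with k | ⟨k, k'⟩
        · exact ⟨x', k, h3.le, h6⟩
        · exact ⟨x' + 1, k', by omega,
            fun h => cy1 (((hI y (x' + 1)).2 h).trans ((hS x').trans k))⟩

/-! ### The ladder order on the marked boxes of a JM partition. -/

/-- The position of a box in the ladder order. -/
def ladderKey (ℓ : ℕ) (c : ℕ × ℕ) : ℕ ×ₗ (ℕ ×ₗ ℕ) := toLex (ladder ℓ c, toLex c)

/-- Every addable `i`-box of `μ` precedes every removable one in the ladder order. -/
def AddableFirst (ℓ : ℕ) (i : ZMod ℓ) (μ : YoungDiagram) : Prop :=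
  ∀ c d, residue ℓ c = i → residue ℓ d = i → IsAddable μ c → IsRemovable μ d →
    ladderKey ℓ c < ladderKey ℓ d

theorem ladderKey_lt_of_ladder_lt {ℓ : ℕ} {c d : ℕ × ℕ} (h : ladder ℓ c < ladder ℓ d) :
    ladderKey ℓ c < ladderKey ℓ d := by
  rw [ladderKey, ladderKey, Prod.Lex.toLex_lt_toLex]
  exact Or.inl h

theorem add_le_of_lt_of_intCast_eq {ℓ : ℕ} {x y : ℤ} (h : x < y) (hxy : (x : ZMod ℓ) = y) :
    x + ℓ ≤ y := by
  rw [ZMod.intCast_eq_intCast_iff_dvd_sub] at hxy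
  have := Int.le_of_dvd (by omega) hxy
  omega

/-- In an `(ℓ, 0)`-JM partition, an addable box to the lower left of a removable box of the same
residue is on a ladder further to the left. -/
theorem IsJM.ladder_lt_of_row_lt {ℓ : ℕ} (hℓ : 3 ≤ ℓ) {μ : YoungDiagram} (hμ : IsJM ℓ μ)
    {a b c d : ℕ} (hres : residue ℓ (c, d) = residue ℓ (a, b)) (hc : IsAddable μ (c, d))
    (ha : IsRemovable μ (a, b)) (hac : a < c) : ladder ℓ (c, d) < ladder ℓ (a, b) := by
  rw [isJM_iff] at hμ
  have hne := intCast_sub_one_ne (ℓ := ℓ) (by omega)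
  have hres' : (((d : ℤ) - c : ℤ) : ZMod ℓ) = (((b : ℤ) - a : ℤ) : ZMod ℓ) := by
    simpa [residue] using hres
  have hgap : (d : ℤ) - c + 1 ∉ beads μ := (not_mem_beads_iff _ _).2 ⟨d, by rw [hc.lens.2]⟩
  have hgap' : (b : ℤ) - a ∉ beads μ :=
    (not_mem_beads_iff _ _).2 ⟨b, by rw [ha.lens.2]; push_cast; ring⟩
  have hbead : (b : ℤ) - a + 1 ∈ beads μ := ⟨a, by rw [ha.lens.1]; push_cast; ring⟩
  have hdb : d ≤ b := by
    have := μ.rowLen_anti a c hac.le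
    rw [hc.lens.1, ha.lens.1] at this
    by_contra
    have h3 : d = b + 1 := by omega
    have h4 := (isAddable_iff_neighbours _ _ _).1 hc
    have h5 := (isRemovable_iff_neighbours _ _ _).1 ha
    exact h5.2.1 (μ.up_left_mem (i2 := c - 1 + 1) (j2 := b) (by omega) le_rfl
      (by have := h4.2.2 b h3; rwa [Nat.sub_add_cancel (by omega)]))
  -- Otherwise `x`, together with the bead of row `a`, the gap of column `d` on the same runner and
  -- the gap of column `b`, is a forbidden configuration.
  have hrun : ∀ x ∈ beads μ, (d : ℤ) - c + 1 < x →
      (((d : ℤ) - c + 1 : ℤ) : ZMod ℓ) = x := by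
    intro x hx hlt
    by_contra hcon
    refine hμ.elim hbead hgap (by omega) (by push_cast at hres' ⊢; rw [hres'])
      ⟨_, hgap', by omega, fun h => hne ((b : ℤ) - a + 1) ?_⟩ ⟨x, hx, hlt.le, hcon⟩
    rw [← h, add_sub_cancel_right]
  -- Above row `c` all beads are to the right of this gap, hence on its runner, and successive ones
  -- differ by at least `ℓ`.
  have hstep : ∀ k : ℕ, k < c → (d : ℤ) - c + 1 + ℓ * (k + 1) ≤
      (μ.rowLen (c - 1 - k) : ℤ) - (c - 1 - k : ℕ) := by
    intro k
    induction k with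
    | zero =>
      intro hk
      have h0 := μ.rowLen_anti (c - 1) c (by omega)
      rw [hc.lens.1] at h0
      have h1 : (μ.rowLen (c - 1) : ℤ) - (c - 1 : ℕ) ∈ beads μ := ⟨_, rfl⟩
      have h2 : (d : ℤ) - c + 1 ≠ (μ.rowLen (c - 1) : ℤ) - (c - 1 : ℕ) := fun h => hgap (h ▸ h1)
      have h3 : (d : ℤ) - c + 1 < (μ.rowLen (c - 1) : ℤ) - (c - 1 : ℕ) := by omega
      have := add_le_of_lt_of_intCast_eq h3 (hrun _ h1 h3)
      simpa using this
    | succ k ih =>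
      intro hk
      have hk' := ih (by omega)
      have h0 := μ.rowLen_anti (c - 1 - (k + 1)) (c - 1 - k) (by omega)
      have hpos : (0 : ℤ) ≤ ℓ * (k + 1) := by positivity
      have h1 : (μ.rowLen (c - 1 - k) : ℤ) - (c - 1 - k : ℕ) <
          (μ.rowLen (c - 1 - (k + 1)) : ℤ) - (c - 1 - (k + 1) : ℕ) := by omega
      have hl : (0 : ℤ) < ℓ := by omega
      have h3 : (d : ℤ) - c + 1 < (μ.rowLen (c - 1 - k) : ℤ) - (c - 1 - k : ℕ) := by
        have : (0 : ℤ) < ℓ * (k + 1) := by positivity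
        omega
      have := add_le_of_lt_of_intCast_eq h1
        ((hrun _ ⟨_, rfl⟩ h3).symm.trans (hrun _ ⟨_, rfl⟩ (h3.trans h1)))
      push_cast
      linarith
  have hfin := hstep (c - 1 - a) (by omega)
  rw [show c - 1 - (c - 1 - a) = a by omega, ha.lens.1] at hfin
  obtain ⟨m, rfl⟩ : ∃ m, c = a + m + 1 := ⟨c - a - 1, by omega⟩
  obtain ⟨n, rfl⟩ : ∃ n, b = d + n := ⟨b - d, by omega⟩
  obtain ⟨l, rfl⟩ : ∃ l, ℓ = l + 3 := ⟨ℓ - 3, by omega⟩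
  rw [show a + m + 1 - 1 - a = m by omega] at hfin
  push_cast at hfin
  simp only [ladder, show l + 3 - 1 = l + 2 by omega]
  -- This says `(ℓ - 1) * (c - a) ≤ b - d`. The ladders compare strictly because `(ℓ - 1)² > 1`,
  -- which uses `ℓ ≥ 3`.
  have hfin' : (l + 2) * (m + 1) ≤ n := by zify; linarith
  nlinarith

/-- In an `(ℓ, 0)`-JM partition, an addable box to the upper right of a removable box of the same
residue is on a ladder weakly to the left, and it is in a higher row. -/
theorem IsJM.ladder_le_of_row_le {ℓ : ℕ} (hℓ : 3 ≤ ℓ) {μ : YoungDiagram} (hμ : IsJM ℓ μ)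
    {a b c d : ℕ} (hres : residue ℓ (c, d) = residue ℓ (a, b)) (hc : IsAddable μ (c, d))
    (ha : IsRemovable μ (a, b)) (hac : c ≤ a) :
    ladder ℓ (c, d) ≤ ladder ℓ (a, b) ∧ c < a := by
  rw [isJM_iff] at hμ
  have hne := intCast_sub_one_ne (ℓ := ℓ) (by omega)
  have hres' : (((d : ℤ) - c : ℤ) : ZMod ℓ) = (((b : ℤ) - a : ℤ) : ZMod ℓ) := by
    simpa [residue] using hres
  have hgap : (b : ℤ) - a ∉ beads μ :=
    (not_mem_beads_iff _ _).2 ⟨b, by rw [ha.lens.2]; push_cast; ring⟩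
  have hbead : (d : ℤ) - c ∈ beads μ := ⟨c, by rw [hc.lens.1]⟩
  have hbead' : (b : ℤ) - a + 1 ∈ beads μ := ⟨a, by rw [ha.lens.1]; push_cast; ring⟩
  have hbd : b < d := by
    have := μ.rowLen_anti c a hac
    rw [hc.lens.1, ha.lens.1] at this
    omega
  -- The dual argument: here the bead of row `a` is the one off the runner, and it forces the gaps
  -- to the left of the bead of row `c` onto that bead's runner.
  have hrun : ∀ y ∉ beads μ, y < (d : ℤ) - c → (y : ZMod ℓ) = (((d : ℤ) - c : ℤ) : ZMod ℓ) := by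
    intro y hy hlt
    by_contra hcon
    refine hμ.elim hbead hgap (by omega) hres'.symm ⟨y, hy, hlt.le, hcon⟩
      ⟨_, hbead', by omega, fun h => hne ((b : ℤ) - a + 1) ?_⟩
    rw [← h, add_sub_cancel_right]
  have hcol : ∀ j : ℕ, (j : ℤ) - μ.colLen j + 1 ∉ beads μ :=
    fun j => (not_mem_beads_iff _ _).2 ⟨j, rfl⟩
  have hstep : ∀ k : ℕ, k < d → ((d - 1 - k : ℕ) : ℤ) - μ.colLen (d - 1 - k) + 1 + ℓ * (k + 1) ≤
      (d : ℤ) - c := by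
    intro k
    induction k with
    | zero =>
      intro hk
      have h0 := μ.colLen_anti (d - 1) d (by omega)
      rw [hc.lens.2] at h0
      have h2 : ((d - 1 : ℕ) : ℤ) - μ.colLen (d - 1) + 1 ≠ (d : ℤ) - c :=
        fun h => hcol (d - 1) (h ▸ hbead)
      have h3 : ((d - 1 : ℕ) : ℤ) - μ.colLen (d - 1) + 1 < (d : ℤ) - c := by omega
      have := add_le_of_lt_of_intCast_eq h3 (hrun _ (hcol _) h3)
      simpa using this
    | succ k ih =>
      intro hk
      have hk' := ih (by omega)
      have h0 := μ.colLen_anti (d - 1 - (k + 1)) (d - 1 - k) (by omega)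
      have hl : (0 : ℤ) < ℓ := by omega
      have hpos : (0 : ℤ) < ℓ * (k + 1) := by positivity
      have h1 : ((d - 1 - (k + 1) : ℕ) : ℤ) - μ.colLen (d - 1 - (k + 1)) + 1 <
          ((d - 1 - k : ℕ) : ℤ) - μ.colLen (d - 1 - k) + 1 := by omega
      have h3 : ((d - 1 - k : ℕ) : ℤ) - μ.colLen (d - 1 - k) + 1 < (d : ℤ) - c := by omega
      have := add_le_of_lt_of_intCast_eq h1
        ((hrun _ (hcol _) (h1.trans h3)).trans (hrun _ (hcol _) h3).symm)
      push_cast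
      linarith
  have hfin := hstep (d - 1 - b) (by omega)
  rw [show d - 1 - (d - 1 - b) = b by omega, ha.lens.2] at hfin
  obtain ⟨m, rfl⟩ : ∃ m, d = b + m + 1 := ⟨d - b - 1, by omega⟩
  obtain ⟨n, rfl⟩ : ∃ n, a = c + n := ⟨a - c, by omega⟩
  obtain ⟨l, rfl⟩ : ∃ l, ℓ = l + 3 := ⟨ℓ - 3, by omega⟩
  rw [show b + m + 1 - 1 - b = m by omega] at hfin
  push_cast at hfin
  simp only [ladder, show l + 3 - 1 = l + 2 by omega]
  -- This says `(ℓ - 1) * (d - b) ≤ a - c`. Equality means a common ladder, and then reading from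
  -- top to bottom puts the addable box first.
  have hfin' : (l + 2) * (m + 1) ≤ n := by zify; linarith
  constructor <;> nlinarith

theorem IsJM.addableFirst {ℓ : ℕ} (hℓ : 3 ≤ ℓ) {μ : YoungDiagram} (hμ : IsJM ℓ μ) (i : ZMod ℓ) :
    AddableFirst ℓ i μ := by
  rintro ⟨c, d⟩ ⟨a, b⟩ h1 h2 hc ha
  rcases lt_or_ge a c with h | h
  · exact ladderKey_lt_of_ladder_lt (hμ.ladder_lt_of_row_lt hℓ (h1.trans h2.symm) hc ha h)
  · obtain ⟨h3, h4⟩ := hμ.ladder_le_of_row_le hℓ (h1.trans h2.symm) hc ha h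
    rcases h3.lt_or_eq with h5 | h5
    · exact ladderKey_lt_of_ladder_lt h5
    · rw [ladderKey, ladderKey, Prod.Lex.toLex_lt_toLex]
      exact Or.inr ⟨h5, Prod.Lex.toLex_lt_toLex.2 (Or.inl h4)⟩

/-! ### Signatures without cancellation, and single steps of the operators. -/

/-- This is why adding or removing one `i`-box leaves the marks of all other `i`-boxes unchanged. -/
theorem residue_ne_of_succ {ℓ : ℕ} (hℓ : 1 < ℓ) (a b : ℕ) :
    residue ℓ (a + 1, b) ≠ residue ℓ (a, b) ∧ residue ℓ (a, b + 1) ≠ residue ℓ (a, b) := by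
  have : Fact (1 < ℓ) := ⟨hℓ⟩
  constructor <;> simp [residue, sub_eq_add_neg]

/-- Addable and removable boxes of residue `i` after an addable `i`-box has been added. -/
theorem marked_of_insert {ℓ : ℕ} (hℓ : 1 < ℓ) {μ ν : YoungDiagram} {c : ℕ × ℕ}
    (hc : IsAddable μ c) (hν : ∀ d, d ∈ ν ↔ d ∈ μ ∨ d = c) (d : ℕ × ℕ)
    (hd : residue ℓ d = residue ℓ c) :
    (IsAddable ν d ↔ IsAddable μ d ∧ d ≠ c) ∧ (IsRemovable ν d ↔ IsRemovable μ d ∨ d = c) := by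
  obtain ⟨a, b⟩ := d
  have h1 : (a + 1, b) ≠ c := fun h => (residue_ne_of_succ hℓ a b).1 (h ▸ hd.symm)
  have h2 : (a, b + 1) ≠ c := fun h => (residue_ne_of_succ hℓ a b).2 (h ▸ hd.symm)
  have h3 : ∀ a', a = a' + 1 → (a', b) ≠ c := by
    rintro a' rfl h
    exact (residue_ne_of_succ hℓ a' b).1 (h ▸ hd)
  have h4 : ∀ b', b = b' + 1 → (a, b') ≠ c := by
    rintro b' rfl h
    exact (residue_ne_of_succ hℓ a b').2 (h ▸ hd)
  constructor
  · rw [isAddable_iff_neighbours, isAddable_iff_neighbours]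
    simp only [hν]
    constructor
    · rintro ⟨h5, h6, h7⟩
      push Not at h5
      exact ⟨⟨h5.1, fun a' h => (h6 a' h).resolve_right (h3 a' h),
        fun b' h => (h7 b' h).resolve_right (h4 b' h)⟩, h5.2⟩
    · rintro ⟨⟨h5, h6, h7⟩, h8⟩
      exact ⟨not_or_intro h5 h8, fun a' h => Or.inl (h6 a' h), fun b' h => Or.inl (h7 b' h)⟩
  · rw [isRemovable_iff_neighbours, isRemovable_iff_neighbours]
    simp only [hν, h1, h2, or_false]
    constructor
    · rintro ⟨h5 | h5, h6⟩
      · exact Or.inl ⟨h5, h6⟩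
      · exact Or.inr h5
    · rintro (⟨h5, h6⟩ | h5)
      · exact ⟨Or.inl h5, h6⟩
      · subst h5
        exact ⟨Or.inr rfl, fun h => hc.1 (μ.up_left_mem (Nat.le_succ a) le_rfl h),
          fun h => hc.1 (μ.up_left_mem le_rfl (Nat.le_succ b) h)⟩

/-- A removal is an insertion read backwards, so `marked_of_insert` serves for both operators. -/
theorem IsRemovable.isAddable_of_erase {μ ν : YoungDiagram} {c : ℕ × ℕ} (hc : IsRemovable μ c)
    (hν : ∀ d, d ∈ ν ↔ d ∈ μ ∧ d ≠ c) : IsAddable ν c := by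
  rw [isAddable_iff]
  refine ⟨fun h => ((hν c).1 h).2 rfl, fun d hd hne => (hν d).2 ⟨?_, hne⟩⟩
  exact μ.isLowerSet (Finset.mem_Iic.1 hd) hc.1

theorem mem_signature {ℓ : ℕ} {i : ZMod ℓ} {μ : YoungDiagram} {c : ℕ × ℕ} :
    c ∈ signature ℓ i μ ↔ residue ℓ c = i ∧ (IsAddable μ c ∨ IsRemovable μ c) := by
  rw [← mem_markedBoxes]
  simp only [signature, List.mem_map, Finset.mem_sort, Finset.mem_image]
  constructor
  · rintro ⟨_, ⟨d, hd, rfl⟩, rfl⟩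
    exact hd
  · exact fun h => ⟨_, ⟨c, h, rfl⟩, rfl⟩

theorem pairwise_signature (ℓ : ℕ) (i : ZMod ℓ) (μ : YoungDiagram) :
    (signature ℓ i μ).Pairwise fun c d => ladderKey ℓ c < ladderKey ℓ d := by
  rw [signature, List.pairwise_map]
  refine (Finset.sortedLT_sort _).pairwise.imp_of_mem ?_
  intro k k' hk hk' hlt
  rw [Finset.mem_sort, Finset.mem_image] at hk hk'
  obtain ⟨c, -, rfl⟩ := hk
  obtain ⟨d, -, rfl⟩ := hk'
  exact hlt

theorem cancel_eq_self {μ : YoungDiagram} {w : List (ℕ × ℕ)}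
    (h : w.Pairwise fun c d => ¬ (c ∈ μ ∧ d ∉ μ)) : cancel μ w = w := by
  induction h with
  | nil => rfl
  | @cons c w hc _ ih =>
    change consCancel μ c (cancel μ w) = c :: w
    rw [ih]
    cases w with
    | nil => rfl
    | cons d w => simp only [consCancel, if_neg (hc d List.mem_cons_self)]

/-- The word already has the form `+⋯+-⋯-`, since no removable box precedes an addable one. -/
theorem AddableFirst.reducedSignature_eq {ℓ : ℕ} {i : ZMod ℓ} {μ : YoungDiagram}
    (h : AddableFirst ℓ i μ) : reducedSignature ℓ i μ = signature ℓ i μ := by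
  refine cancel_eq_self ((pairwise_signature ℓ i μ).imp_of_mem ?_)
  rintro c d hc hd hlt ⟨hcμ, hdμ⟩
  rw [mem_signature] at hc hd
  exact lt_asymm hlt (h d c hd.1 hc.1 (hd.2.resolve_right fun h => hdμ h.1)
    (hc.2.resolve_left fun h => h.1 hcμ))

theorem AddableFirst.mem_conormalBoxes {ℓ : ℕ} {i : ZMod ℓ} {μ : YoungDiagram}
    (h : AddableFirst ℓ i μ) {c : ℕ × ℕ} :
    c ∈ conormalBoxes ℓ i μ ↔ residue ℓ c = i ∧ IsAddable μ c := by
  simp only [conormalBoxes, h.reducedSignature_eq, List.mem_filter, mem_signature,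
    decide_eq_true_eq]
  constructor
  · rintro ⟨⟨h1, h2⟩, h3⟩
    exact ⟨h1, h2.resolve_right fun h => h3 h.1⟩
  · rintro ⟨h1, h2⟩
    exact ⟨⟨h1, Or.inl h2⟩, h2.1⟩

theorem AddableFirst.mem_normalBoxes {ℓ : ℕ} {i : ZMod ℓ} {μ : YoungDiagram}
    (h : AddableFirst ℓ i μ) {c : ℕ × ℕ} :
    c ∈ normalBoxes ℓ i μ ↔ residue ℓ c = i ∧ IsRemovable μ c := by
  simp only [normalBoxes, h.reducedSignature_eq, List.mem_filter, mem_signature,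
    decide_eq_true_eq]
  constructor
  · rintro ⟨⟨h1, h2⟩, h3⟩
    exact ⟨h1, h2.resolve_left fun h => h.1 h3⟩
  · rintro ⟨h1, h2⟩
    exact ⟨⟨h1, Or.inr h2⟩, h2.1⟩

theorem AddableFirst.pairwise_conormalBoxes {ℓ : ℕ} {i : ZMod ℓ} {μ : YoungDiagram}
    (h : AddableFirst ℓ i μ) :
    (conormalBoxes ℓ i μ).Pairwise fun c d => ladderKey ℓ c < ladderKey ℓ d := by
  rw [conormalBoxes, h.reducedSignature_eq]
  exact (pairwise_signature ℓ i μ).filter _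

theorem AddableFirst.pairwise_normalBoxes {ℓ : ℕ} {i : ZMod ℓ} {μ : YoungDiagram}
    (h : AddableFirst ℓ i μ) :
    (normalBoxes ℓ i μ).Pairwise fun c d => ladderKey ℓ c < ladderKey ℓ d := by
  rw [normalBoxes, h.reducedSignature_eq]
  exact (pairwise_signature ℓ i μ).filter _

theorem nodup_of_pairwise_ladderKey {ℓ : ℕ} {w : List (ℕ × ℕ)}
    (h : w.Pairwise fun c d => ladderKey ℓ c < ladderKey ℓ d) : w.Nodup := by
  refine List.Pairwise.imp ?_ h
  rintro c d hlt rfl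
  exact lt_irrefl _ hlt

theorem length_eq_succ_of_mem_iff {α : Type*} [DecidableEq α] {v w : List α} (hv : v.Nodup)
    (hw : w.Nodup) {c : α} (hc : c ∈ w) (h : ∀ d, d ∈ v ↔ d ∈ w ∧ d ≠ c) :
    w.length = v.length + 1 := by
  rw [← List.toFinset_card_of_nodup hv, ← List.toFinset_card_of_nodup hw,
    ← Finset.card_erase_add_one (List.mem_toFinset.2 hc)]
  congr 2
  ext d
  rw [Finset.mem_erase, List.mem_toFinset, List.mem_toFinset, h, and_comm]

/-- If all addable `i`-boxes precede all removable ones, then `f̂_i` adds the last addable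
`i`-box, and the order of the boxes persists. -/
theorem AddableFirst.fHat_step {ℓ : ℕ} (hℓ : 1 < ℓ) {i : ZMod ℓ} {μ : YoungDiagram}
    (h : AddableFirst ℓ i μ) {n : ℕ} (hn : phiHat ℓ i μ = n + 1) :
    ∃ (ν : YoungDiagram) (c : ℕ × ℕ), fHat ℓ i μ = some ν ∧ residue ℓ c = i ∧ IsAddable μ c ∧
      (∀ d, d ∈ ν ↔ d ∈ μ ∨ d = c) ∧ AddableFirst ℓ i ν ∧ phiHat ℓ i ν = n := by
  have hne : conormalBoxes ℓ i μ ≠ [] := by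
    intro h0
    rw [phiHat, h0] at hn
    simp at hn
  obtain ⟨w, c, hw⟩ : ∃ w c, conormalBoxes ℓ i μ = w ++ [c] :=
    ⟨_, _, (List.dropLast_append_getLast hne).symm⟩
  have hcm : c ∈ conormalBoxes ℓ i μ := by rw [hw]; simp
  obtain ⟨hres, hc⟩ := h.mem_conormalBoxes.1 hcm
  have hmax : ∀ d, residue ℓ d = i → IsAddable μ d → d ≠ c → ladderKey ℓ d < ladderKey ℓ c := by
    intro d hd hda hdc
    have hp := h.pairwise_conormalBoxes
    have hdm := h.mem_conormalBoxes.2 ⟨hd, hda⟩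
    rw [hw] at hp hdm
    exact (List.pairwise_append.1 hp).2.2 d (by simpa [hdc] using hdm) c (by simp)
  let ν : YoungDiagram := ⟨insert c μ.cells, hc.2⟩
  have hν : ∀ d, d ∈ ν ↔ d ∈ μ ∨ d = c := by
    intro d
    rw [← YoungDiagram.mem_cells, ← YoungDiagram.mem_cells, Finset.mem_insert, or_comm]
  have hA : ∀ d, residue ℓ d = i → (IsAddable ν d ↔ IsAddable μ d ∧ d ≠ c) :=
    fun d hd => (marked_of_insert hℓ hc hν d (hd.trans hres.symm)).1
  have hR : ∀ d, residue ℓ d = i → (IsRemovable ν d ↔ IsRemovable μ d ∨ d = c) :=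
    fun d hd => (marked_of_insert hℓ hc hν d (hd.trans hres.symm)).2
  -- The only new removable `i`-box is `c`, and `hmax` puts the remaining addable ones before it.
  have hνA : AddableFirst ℓ i ν := by
    intro d e hd he hda her
    rw [hA d hd] at hda
    rw [hR e he] at her
    rcases her with her | rfl
    · exact h d e hd he hda.1 her
    · exact hmax d hd hda.1 hda.2
  refine ⟨ν, c, ?_, hres, hc, hν, hνA, ?_⟩
  · rw [fHat, hw, List.getLast?_concat, Option.bind_some, addBox, dif_pos hc]
  · have := length_eq_succ_of_mem_iff (nodup_of_pairwise_ladderKey hνA.pairwise_conormalBoxes)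
      (nodup_of_pairwise_ladderKey h.pairwise_conormalBoxes) hcm (fun d => by
        rw [hνA.mem_conormalBoxes, h.mem_conormalBoxes, and_assoc]
        exact and_congr_right (hA d))
    rw [phiHat] at hn ⊢
    omega

/-- If all addable `i`-boxes precede all removable ones, then `ê_i` removes the first removable
`i`-box, and the order of the boxes persists. -/
theorem AddableFirst.eHat_step {ℓ : ℕ} (hℓ : 1 < ℓ) {i : ZMod ℓ} {μ : YoungDiagram}
    (h : AddableFirst ℓ i μ) {n : ℕ} (hn : epsilonHat ℓ i μ = n + 1) :
    ∃ (ν : YoungDiagram) (c : ℕ × ℕ), eHat ℓ i μ = some ν ∧ residue ℓ c = i ∧ IsRemovable μ c ∧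
      (∀ d, d ∈ ν ↔ d ∈ μ ∧ d ≠ c) ∧ AddableFirst ℓ i ν ∧ epsilonHat ℓ i ν = n := by
  obtain ⟨c, w, hw⟩ : ∃ c w, normalBoxes ℓ i μ = c :: w := by
    refine List.exists_cons_of_ne_nil fun h0 => ?_
    rw [epsilonHat, h0] at hn
    simp at hn
  have hcm : c ∈ normalBoxes ℓ i μ := by rw [hw]; simp
  obtain ⟨hres, hc⟩ := h.mem_normalBoxes.1 hcm
  have hmin : ∀ d, residue ℓ d = i → IsRemovable μ d → d ≠ c →
      ladderKey ℓ c < ladderKey ℓ d := by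
    intro d hd hda hdc
    have hp := h.pairwise_normalBoxes
    have hdm := h.mem_normalBoxes.2 ⟨hd, hda⟩
    rw [hw] at hp hdm
    exact (List.pairwise_cons.1 hp).1 d (by simpa [hdc] using hdm)
  let ν : YoungDiagram := ⟨μ.cells.erase c, hc.2⟩
  have hν : ∀ d, d ∈ ν ↔ d ∈ μ ∧ d ≠ c := by
    intro d
    rw [← YoungDiagram.mem_cells, ← YoungDiagram.mem_cells, Finset.mem_erase, and_comm]
  have hcν := hc.isAddable_of_erase hν
  have hν' : ∀ d, d ∈ μ ↔ d ∈ ν ∨ d = c := by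
    intro d
    rw [hν]
    by_cases hdc : d = c
    · simp [hdc, hc.1]
    · simp [hdc]
  have hA : ∀ d, residue ℓ d = i → (IsAddable ν d ↔ IsAddable μ d ∨ d = c) := by
    intro d hd
    rw [(marked_of_insert hℓ hcν hν' d (hd.trans hres.symm)).1]
    by_cases hdc : d = c
    · simp [hdc, hcν]
    · simp [hdc]
  have hR : ∀ d, residue ℓ d = i → (IsRemovable ν d ↔ IsRemovable μ d ∧ d ≠ c) := by
    intro d hd
    rw [(marked_of_insert hℓ hcν hν' d (hd.trans hres.symm)).2]
    by_cases hdc : d = c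
    · simp only [hdc, ne_eq, not_true_eq_false, and_false, iff_false]
      exact fun hr => hcν.1 hr.1
    · simp [hdc]
  -- The only new addable `i`-box is `c`, and `hmin` puts it before the remaining removable ones.
  have hνA : AddableFirst ℓ i ν := by
    intro d e hd he hda her
    rw [hA d hd] at hda
    rw [hR e he] at her
    rcases hda with hda | rfl
    · exact h d e hd he hda her.1
    · exact hmin e he her.1 her.2
  refine ⟨ν, c, ?_, hres, hc, hν, hνA, ?_⟩
  · rw [eHat, hw, List.head?_cons, Option.bind_some, removeBox, dif_pos hc]
  · have := length_eq_succ_of_mem_iff (nodup_of_pairwise_ladderKey hνA.pairwise_normalBoxes)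
      (nodup_of_pairwise_ladderKey h.pairwise_normalBoxes) hcm (fun d => by
        rw [hνA.mem_normalBoxes, h.mem_normalBoxes, and_assoc]
        exact and_congr_right (hR d))
    rw [epsilonHat] at hn ⊢
    omega

/-! ### The maximal powers of the operators. -/

theorem iterate_succ (g : YoungDiagram → Option YoungDiagram) (k : ℕ) {μ ν : YoungDiagram}
    (h : g μ = some ν) : iterate g (k + 1) μ = iterate g k ν := by
  rw [iterate, Function.iterate_succ_apply, Option.bind_some, h, iterate]

/-- Each step uses up one addable `i`-box and creates none. The invariant is `AddableFirst`; nothing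
is claimed about the JM property of the intermediate partitions. -/
theorem AddableFirst.iterate_fHat {ℓ : ℕ} (hℓ : 1 < ℓ) {i : ZMod ℓ} {n : ℕ} :
    ∀ {μ : YoungDiagram}, AddableFirst ℓ i μ → phiHat ℓ i μ = n →
      ∃ ν, iterate (fHat ℓ i) n μ = some ν ∧
        ∀ d, d ∈ ν ↔ d ∈ μ ∨ (residue ℓ d = i ∧ IsAddable μ d) := by
  induction n with
  | zero =>
    intro μ h hn
    refine ⟨μ, rfl, fun d => ⟨Or.inl, fun hd => hd.resolve_right fun hd => ?_⟩⟩
    rw [← h.mem_conormalBoxes, List.length_eq_zero_iff.1 hn] at hd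
    simp at hd
  | succ n ih =>
    intro μ h hn
    obtain ⟨κ, c, hf, hres, hc, hκ, hκA, hκn⟩ := h.fHat_step hℓ hn
    obtain ⟨ν, hν, hm⟩ := ih hκA hκn
    refine ⟨ν, (iterate_succ _ _ hf).trans hν, fun d => ?_⟩
    have hA := fun hd : residue ℓ d = i =>
      (marked_of_insert hℓ hc hκ d (hd.trans hres.symm)).1
    rw [hm, hκ]
    by_cases hdc : d = c
    · simp [hdc, hres, hc]
    · simp only [hdc, or_false]
      refine or_congr_right (and_congr_right fun hd => ?_)
      simp [hA hd, hdc]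

theorem AddableFirst.iterate_eHat {ℓ : ℕ} (hℓ : 1 < ℓ) {i : ZMod ℓ} {n : ℕ} :
    ∀ {μ : YoungDiagram}, AddableFirst ℓ i μ → epsilonHat ℓ i μ = n →
      ∃ ν, iterate (eHat ℓ i) n μ = some ν ∧
        ∀ d, d ∈ ν ↔ d ∈ μ ∧ ¬ (residue ℓ d = i ∧ IsRemovable μ d) := by
  induction n with
  | zero =>
    intro μ h hn
    refine ⟨μ, rfl, fun d => ⟨fun hd => ⟨hd, fun hd' => ?_⟩, And.left⟩⟩
    rw [← h.mem_normalBoxes, List.length_eq_zero_iff.1 hn] at hd'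
    simp at hd'
  | succ n ih =>
    intro μ h hn
    obtain ⟨κ, c, hf, hres, hc, hκ, hκA, hκn⟩ := h.eHat_step hℓ hn
    obtain ⟨ν, hν, hm⟩ := ih hκA hκn
    refine ⟨ν, (iterate_succ _ _ hf).trans hν, fun d => ?_⟩
    have hκ' : ∀ e, e ∈ μ ↔ e ∈ κ ∨ e = c := by
      intro e
      rw [hκ]
      by_cases hec : e = c
      · simp [hec, hc.1]
      · simp [hec]
    have hR := fun hd : residue ℓ d = i =>
      (marked_of_insert hℓ (hc.isAddable_of_erase hκ) hκ' d (hd.trans hres.symm)).2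
    rw [hm, hκ]
    by_cases hdc : d = c
    · simp [hdc, hres, hc]
    · simp only [hdc, ne_eq, not_false_eq_true, and_true]
      refine and_congr_right fun _ => not_congr (and_congr_right fun hd => ?_)
      simp [hR hd, hdc]

end LadderCrystal

theorem mainTheorem8 (ℓ : ℕ) (hℓ : 3 ≤ ℓ) (i : ZMod ℓ) (lam : YoungDiagram)
    (hlam : LadderCrystal.IsJM ℓ lam) :
    (∃ ν : YoungDiagram,
      LadderCrystal.iterate (LadderCrystal.fHat ℓ i) (LadderCrystal.phiHat ℓ i lam) lam = some ν ∧
        LadderCrystal.IsJM ℓ ν) ∧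
    (∃ ν : YoungDiagram,
      LadderCrystal.iterate (LadderCrystal.eHat ℓ i) (LadderCrystal.epsilonHat ℓ i lam) lam =
          some ν ∧
        LadderCrystal.IsJM ℓ ν) := by
  have hfirst := hlam.addableFirst hℓ i
  have hbeads := (LadderCrystal.isJM_iff ℓ lam).1 hlam
  constructor
  · obtain ⟨ν, hν, hm⟩ := hfirst.iterate_fHat (by omega) rfl
    exact ⟨ν, hν, (LadderCrystal.isJM_iff ℓ ν).2
      (hbeads.add (by omega) (LadderCrystal.mem_beads_of_add hm))⟩
  · obtain ⟨ν, hν, hm⟩ := hfirst.iterate_eHat (by omega) rfl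
    exact ⟨ν, hν, (LadderCrystal.isJM_iff ℓ ν).2
      (hbeads.remove (by omega) (LadderCrystal.mem_beads_of_remove hm))⟩
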